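/- Let $(\mathbb{N}_0,b,m)$ be a birth-death chain, that is, $b\colon \mathbb{N}_0\times\mathbb{N}_0\to[0,\infty)$ is symmetric with $b(x,y)>0$ if and only if $|x-y|=1$, and $m\colon\mathbb{N}_0\to(0,\infty)$. Let $\ell^2(\mathbb{N}_0,m)$ be the real Hilbert space of functions $f\colon\mathbb{N}_0\to\mathbb{R}$ with $\|f\|^2=\sum_x f(x)^2m(x)<\infty$, with inner product $\langle f,g\rangle=\sum_x f(x)g(x)m(x)$. For $f\colon\mathbb{N}_0\to\mathbb{R}$ let $$\Delta f(x)=\frac{1}{m(x)}\sum_{y}b(x,y)\,(f(x)-f(y)),\qquad \mathcal{Q}(f)=\frac12\sum_{x,y}b(x,y)\,(f(x)-f(y))^2\in[0,\infty].$$ Let $L_c$ be the restriction of $\Delta$ to the finitely supported functions, regarded as an operator on $\ell^2(\mathbb{N}_0,m)$, and let $L_c^*$ be its adjoint (which is a restriction of $\Delta$, so that $L_c^*f=\Delta f$). Call $L_c$ essentially self-adjoint if it has a unique self-adjoint extension. Put $H^2=\{f\in D(L_c^*) : \mathcal{Q}(f)<\infty\}$ with $\|f\|_{H^2}^2=\|f\|^2+\|\Delta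 f\|^2+\mathcal{Q}(f)$, and for $n\in\mathbb{N}_0$ let $\mathcal{C}_n=\{f\in H^2 : f(r)=1 \text{ for all } r\ge n\}$. The $(2,2)$-capacity at infinity is $$\mathrm{Cap}_{2,2}(\infty)=\begin{cases}\infty & \text{if } \mathcal{C}_n=\emptyset \text{ for some } n\in\mathbb{N}_0,\\ \lim_{n\to\infty}\inf_{f\in\mathcal{C}_n}\|f\|_{H^2}^2 & \text{otherwise.}\end{cases}$$ Then the following statements are equivalent: (i) $L_c$ is essentially self-adjoint. (ii) $\mathrm{Cap}_{2,2}(\infty)=0$ or $\mathrm{Cap}_{2,2}(\infty)=\infty$. -/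

import Mathlib

open MeasureTheory Filter
open scoped ENNReal

/-- A weighted graph `(X, b, m)` over a vertex set `X`: a symmetric edge weight `b ≥ 0` that vanishes
on the diagonal and is summable at every vertex, and a strictly positive vertex measure `m`. -/
structure WeightedGraph (X : Type*) where
  b : X → X → ℝ
  m : X → ℝ
  b_nonneg : ∀ x y, 0 ≤ b x y
  b_symm : ∀ x y, b x y = b y x
  b_diag : ∀ x, b x x = 0
  b_summable : ∀ x, Summable (b x)
  m_pos : ∀ x, 0 < m x

namespace WeightedGraph

variable {X : Type*} (G : WeightedGraph X)

/-- The energy `Q(f) = 1/2 ∑_{x,y} b(x,y) (f(x) - f(y))²`, with values in `[0, ∞]`. -/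
noncomputable def energy (f : X → ℝ) : ℝ≥0∞ :=
  (1 / 2) * ∑' x, ∑' y, ENNReal.ofReal (G.b x y * (f x - f y) ^ 2)

/-- The formal Laplacian `Δ f(x) = 1/m(x) ∑_y b(x,y) (f(x) - f(y))`. -/
noncomputable def laplacian (f : X → ℝ) (x : X) : ℝ :=
  1 / G.m x * ∑' y, G.b x y * (f x - f y)

/-- The vertex measure, extended to all subsets by additivity. -/
noncomputable def measure [MeasurableSpace X] : Measure X :=
  Measure.sum fun x => ENNReal.ofReal (G.m x) • Measure.dirac x

/-- The real Hilbert space `ℓ²(X, m)`. -/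
noncomputable abbrev L2 [MeasurableSpace X] : Type _ := Lp ℝ 2 G.measure

end WeightedGraph

/-- A birth-death chain over `ℕ = {0, 1, 2, …}`: a weighted graph in which exactly the consecutive
numbers are neighbors (so that it is connected). -/
structure BirthDeathChain extends WeightedGraph ℕ where
  b_pos_iff : ∀ x y, 0 < b x y ↔ |(x : ℤ) - (y : ℤ)| = 1

namespace BirthDeathChain

variable (G : BirthDeathChain)

/-- Every vertex has positive mass, so almost everywhere equal functions are equal. -/
theorem eq_of_ae {f g : ℕ → ℝ} (h : f =ᵐ[G.measure] g) : f = g := by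
  funext x
  have h1 : ∀ x, f =ᵐ[ENNReal.ofReal (G.m x) • Measure.dirac x] g :=
    Measure.ae_sum_iff.1 h
  have h2 := h1 x
  have hx : ENNReal.ofReal (G.m x) ≠ 0 := by simpa using G.m_pos x
  have h3 : f =ᵐ[Measure.dirac x] g := (Measure.ae_ennreal_smul_measure_iff hx).1 h2
  rwa [Filter.EventuallyEq, ae_dirac_eq] at h3

theorem coe_add (f g : G.L2) : (⇑(f + g) : ℕ → ℝ) = f + g := G.eq_of_ae (Lp.coeFn_add f g)

theorem coe_smul (c : ℝ) (f : G.L2) : (⇑(c • f) : ℕ → ℝ) = c • f := G.eq_of_ae (Lp.coeFn_smul c f)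

theorem coe_zero : (⇑(0 : G.L2) : ℕ → ℝ) = 0 := G.eq_of_ae (Lp.coeFn_zero ℝ 2 G.measure)

/-- Finitely supported functions are square summable. -/
theorem memLp_of_finite {f : ℕ → ℝ} (hf : (Function.support f).Finite) :
    MemLp f 2 G.measure := by
  refine ⟨(Measurable.of_discrete).aestronglyMeasurable, ?_⟩
  rw [eLpNorm_lt_top_iff_lintegral_rpow_enorm_lt_top (by norm_num) (by norm_num)]
  rw [WeightedGraph.measure, lintegral_sum_measure]
  rw [tsum_eq_sum (s := hf.toFinset)]
  · refine ENNReal.sum_lt_top.2 fun x _ => ?_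
    simp only [lintegral_smul_measure, lintegral_dirac, smul_eq_mul]
    exact ENNReal.mul_lt_top ENNReal.ofReal_lt_top
      (ENNReal.rpow_lt_top_of_nonneg (by norm_num) enorm_ne_top)
  · intro x hx
    have hx' : f x = 0 := by simpa using hx
    simp [lintegral_smul_measure, lintegral_dirac, hx']

theorem b_eq_zero {x y : ℕ} (h : x + 1 < y ∨ y + 1 < x) : G.b x y = 0 := by
  have h1 : ¬ 0 < G.b x y := by
    rw [G.b_pos_iff, abs_eq (by norm_num)]
    omega
  exact le_antisymm (not_lt.1 h1) (G.b_nonneg x y)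

theorem summable_laplacian (f : ℕ → ℝ) (x : ℕ) :
    Summable fun y => G.b x y * (f x - f y) := by
  refine summable_of_hasFiniteSupport ((Set.finite_Iic (x + 1)).subset fun y hy => ?_)
  by_contra h
  exact hy (by simp [G.b_eq_zero (Or.inl (not_le.1 h))])

theorem laplacian_add (f g : ℕ → ℝ) :
    G.laplacian (f + g) = G.laplacian f + G.laplacian g := by
  funext x
  simp only [WeightedGraph.laplacian, Pi.add_apply]
  rw [← mul_add, ← (G.summable_laplacian f x).tsum_add (G.summable_laplacian g x)]
  congr 2
  funext y
  ring

theorem laplacian_smul (c : ℝ) (f : ℕ → ℝ) :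
    G.laplacian (c • f) = c • G.laplacian f := by
  funext x
  simp only [WeightedGraph.laplacian, Pi.smul_apply, smul_eq_mul]
  rw [mul_left_comm, ← tsum_mul_left (a := c)]
  congr 2
  funext y
  ring

/-- The Laplacian of a finitely supported function is finitely supported. -/
theorem laplacian_finite {f : ℕ → ℝ} (hf : (Function.support f).Finite) :
    (Function.support (G.laplacian f)).Finite := by
  obtain ⟨N, hN⟩ := hf.bddAbove
  have h0 : ∀ y, N < y → f y = 0 := fun y hy => by
    by_contra h
    exact absurd (hN h) (not_le.2 hy)
  refine (Set.finite_Iic (N + 1)).subset fun x hx => ?_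
  by_contra h
  have hx1 : N + 1 < x := not_le.1 h
  apply hx
  have h2 : ∀ y, G.b x y * (f x - f y) = 0 := fun y => by
    by_cases hy : N < y
    · simp [h0 x (by omega), h0 y hy]
    · simp [G.b_eq_zero (x := x) (y := y) (Or.inr (by omega))]
  simp [WeightedGraph.laplacian, h2]

/-- The finitely supported functions `C_c`, as a subspace of `ℓ²(ℕ, m)`. -/
noncomputable def Cc : Submodule ℝ G.L2 where
  carrier := {f | (Function.support (f : ℕ → ℝ)).Finite}
  zero_mem' := by
    rw [Set.mem_ofPred_eq, G.coe_zero]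
    simp
  add_mem' := by
    intro f g hf hg
    simp only [Set.mem_ofPred_eq, G.coe_add] at *
    exact (hf.union hg).subset (Function.support_add _ _)
  smul_mem' := by
    intro c f hf
    simp only [Set.mem_ofPred_eq, G.coe_smul] at *
    exact hf.subset (Function.support_const_smul_subset c _)

/-- The operator `L_c = Δ|_{C_c}` on `ℓ²(ℕ, m)`, with domain `C_c`. -/
noncomputable def Lc : G.L2 →ₗ.[ℝ] G.L2 where
  domain := G.Cc
  toFun :=
    { toFun := fun f => (G.memLp_of_finite (G.laplacian_finite f.2)).toLp
        (G.laplacian ((f : G.L2) : ℕ → ℝ))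
      map_add' := fun f g => by
        rw [← MemLp.toLp_add]
        exact MemLp.toLp_congr _ _ (by
          rw [Submodule.coe_add, G.coe_add, G.laplacian_add])
      map_smul' := fun c f => by
        rw [RingHom.id_apply, ← MemLp.toLp_const_smul]
        exact MemLp.toLp_congr _ _ (by
          rw [Submodule.coe_smul, G.coe_smul, G.laplacian_smul]) }

/-- `L_c` is essentially self-adjoint: it has a unique self-adjoint extension. -/
def IsEssentiallySelfAdjoint : Prop :=
  ∃! A : G.L2 →ₗ.[ℝ] G.L2, G.Lc ≤ A ∧ IsSelfAdjoint A

/-- The second order Sobolev space `H² = D(L_c^*) ∩ 𝒟`, where `𝒟` is the set of functions of finite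
energy. -/
def H2 : Set G.Lc.adjoint.domain :=
  {f | G.energy ((f : G.L2) : ℕ → ℝ) < ∞}

/-- The square of the `H²`-norm, `‖f‖² + ‖L_c^* f‖² + Q(f)`. -/
noncomputable def normSqH2 (f : G.Lc.adjoint.domain) : ℝ≥0∞ :=
  ‖(f : G.L2)‖ₑ ^ 2 + ‖G.Lc.adjoint f‖ₑ ^ 2 + G.energy ((f : G.L2) : ℕ → ℝ)

/-- The test functions `𝒞_n`: functions in `H²` that equal `1` from `n` on. -/
def testFunctions (n : ℕ) : Set G.Lc.adjoint.domain :=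
  {f | f ∈ G.H2 ∧ ∀ r : ℕ, n ≤ r → ((f : G.L2) : ℕ → ℝ) r = 1}

open scoped Classical in
/-- The `(2,2)`-capacity at infinity. -/
noncomputable def cap22 : ℝ≥0∞ :=
  if ∃ n, G.testFunctions n = ∅ then ∞
  else limUnder atTop fun n : ℕ => ⨅ f ∈ G.testFunctions n, G.normSqH2 f

/-- The limit in the definition of the capacity always exists. -/
theorem tendsto_cap22 (h : ¬ ∃ n, G.testFunctions n = ∅) :
    Tendsto (fun n : ℕ => ⨅ f ∈ G.testFunctions n, G.normSqH2 f) atTop (nhds G.cap22) := by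
  rw [cap22, if_neg h]
  exact tendsto_nhds_limUnder ⟨_, tendsto_atTop_iInf fun i j hij => biInf_mono fun f hf =>
    ⟨hf.1, fun r hr => hf.2 r (hij.trans hr)⟩⟩

end BirthDeathChain

/-! Both sides are compared with the space of `ℓ²` solutions of `Δu = -u`, the defect space `ker
(L_c^* + 1)`.

Over the reals the deficiency indices at `±i` are not directly at hand. Instead, every `c > 0` gives
a Krein–von Neumann extension containing `ker (L_c^* + c)`. If the self-adjoint extension is unique,
those for `c = 1` and `c = 2` agree, and symmetry makes certain defect vectors for the two shifts
orthogonal. On a birth-death chain a defect vector has constant sign and `|u| ≥ |u(0)|`, so two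
nonzero ones are never orthogonal (`eq_zero_of_inner_defect_eq_zero`). Hence essential
self-adjointness means a trivial defect space (`isEssentiallySelfAdjoint_iff`).

The capacity is infinite exactly when `1 ∉ ℓ²`, and then `|u| ≥ |u(0)|` excludes nonzero defect
vectors. If `1 ∈ ℓ²`, then `Δ1 = 0` and test functions are `1 - φ` with `φ` finitely supported.
Capacity zero thus approximates `1` by such `φ` in graph norm, which forces `⟪u, 1⟫ = 0` and so `u =
0`. Conversely, a trivial defect space puts `1` in the graph closure of `L_c`. -/

/-! ### Krein extensions of nonnegative symmetric operators -/

namespace LinearPMap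

open scoped InnerProductSpace

variable {E : Type*} [NormedAddCommGroup E] [InnerProductSpace ℝ E]

/-- The shifted operator `S + c` on the domain of `S`. -/
def shift (S : E →ₗ.[ℝ] E) (c : ℝ) : S.domain →ₗ[ℝ] E :=
  S.toFun + c • S.domain.subtype

theorem shift_apply (S : E →ₗ.[ℝ] E) (c : ℝ) (x : S.domain) : S.shift c x = S x + c • (x : E) := rfl

/-- Cauchy–Schwarz applied to `⟪(S + c)x, x⟫ ≥ c‖x‖²`. Convergence of `(S + c)φ` thereby forces
convergence of `φ`. -/
theorem norm_le_norm_shift {S : E →ₗ.[ℝ] E} (hn : ∀ x : S.domain, 0 ≤ ⟪S x, (x : E)⟫_ℝ) {c : ℝ}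
    (x : S.domain) : c * ‖(x : E)‖ ≤ ‖S.shift c x‖ := by
  rcases eq_or_ne (x : E) 0 with h | h
  · simp [h]
  have h1 : c * ‖(x : E)‖ * ‖(x : E)‖ ≤ ‖S.shift c x‖ * ‖(x : E)‖ := by
    refine le_trans ?_ (real_inner_le_norm _ _)
    rw [shift_apply, inner_add_left, real_inner_smul_left, real_inner_self_eq_norm_sq]
    linarith [hn x, sq ‖(x : E)‖]
  exact le_of_mul_le_mul_right h1 (norm_pos_iff.2 h)

theorem inner_shift {S : E →ₗ.[ℝ] E} (hs : S.IsFormalAdjoint S) (c : ℝ) (x y : S.domain) :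
    ⟪S.shift c x, (y : E)⟫_ℝ = ⟪(x : E), S.shift c y⟫_ℝ := by
  rw [shift_apply, shift_apply, inner_add_left, inner_add_right, real_inner_smul_left,
    real_inner_smul_right, hs x y]

variable [CompleteSpace E]

/-- The defect space `ker (S† + c)`. -/
noncomputable def defect (S : E →ₗ.[ℝ] E) (c : ℝ) : Submodule ℝ E :=
  (LinearMap.ker (S.adjoint.shift c)).map S.adjoint.domain.subtype

theorem mem_defect_iff {S : E →ₗ.[ℝ] E} {c : ℝ} {u : E} :
    u ∈ S.defect c ↔ ∃ h : u ∈ S.adjoint.domain, S.adjoint ⟨u, h⟩ = -(c • u) := by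
  simp [defect, shift_apply, eq_neg_iff_add_eq_zero]

theorem inner_adjoint_shift {S : E →ₗ.[ℝ] E} (hd : Dense (S.domain : Set E)) (c : ℝ)
    (z : S.adjoint.domain) (x : S.domain) :
    ⟪S.adjoint.shift c z, (x : E)⟫_ℝ = ⟪(z : E), S.shift c x⟫_ℝ := by
  rw [shift_apply, shift_apply, inner_add_left, inner_add_right, real_inner_smul_left,
    real_inner_smul_right, adjoint_isFormalAdjoint hd z x]

theorem mem_defect_of_forall {S : E →ₗ.[ℝ] E} (hd : Dense (S.domain : Set E)) {c : ℝ} {u : E}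
    (hu : ∀ x : S.domain, ⟪u, S.shift c x⟫_ℝ = 0) : u ∈ S.defect c := by
  have h : ∀ x : S.domain, ⟪-(c • u), (x : E)⟫_ℝ = ⟪u, S x⟫_ℝ := fun x => by
    have := hu x
    rw [shift_apply, inner_add_right, real_inner_smul_right] at this
    rw [inner_neg_left, real_inner_smul_left]
    linarith
  exact mem_defect_iff.2 ⟨mem_adjoint_domain_of_exists _ ⟨_, h⟩, adjoint_apply_eq hd _ h⟩

/-- The restriction of `S†` to the vectors that `S† + c` maps to the orthogonal complement of the
defect space `ker (S† + c)`: the Krein–von Neumann extension of `S + c`, shifted back. -/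
noncomputable def kreinExtension (S : E →ₗ.[ℝ] E) (c : ℝ) : E →ₗ.[ℝ] E where
  domain := ((S.defect c)ᗮ.comap (S.adjoint.shift c)).map S.adjoint.domain.subtype
  toFun := S.adjoint.toFun ∘ₗ Submodule.inclusion (Submodule.map_subtype_le _ _)

theorem kreinExtension_le_adjoint (S : E →ₗ.[ℝ] E) (c : ℝ) : S.kreinExtension c ≤ S.adjoint :=
  ⟨Submodule.map_subtype_le _ _, fun _ _ h => congrArg S.adjoint (Subtype.ext h)⟩

theorem mem_kreinExtension_domain {S : E →ₗ.[ℝ] E} {c : ℝ} (z : S.adjoint.domain) :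
    (z : E) ∈ (S.kreinExtension c).domain ↔ S.adjoint.shift c z ∈ (S.defect c)ᗮ := by
  simp [kreinExtension]

theorem defect_le_kreinExtension_domain (S : E →ₗ.[ℝ] E) (c : ℝ) :
    S.defect c ≤ (S.kreinExtension c).domain := by
  intro u hu
  obtain ⟨h, hu⟩ := mem_defect_iff.1 hu
  rw [mem_kreinExtension_domain ⟨u, h⟩, shift_apply, hu, neg_add_cancel]
  exact zero_mem _

variable {S : E →ₗ.[ℝ] E}

/-- The range of `S + c` is orthogonal to `ker (S† + c)`. -/
theorem le_kreinExtension (hd : Dense (S.domain : Set E)) (hs : S.IsFormalAdjoint S) (c : ℝ) :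
    S ≤ S.kreinExtension c := by
  have hle := hs.le_adjoint hd
  refine ⟨fun x hx => ?_, fun x y h => ?_⟩
  · rw [mem_kreinExtension_domain ⟨x, hle.1 hx⟩, Submodule.mem_orthogonal]
    intro u hu
    obtain ⟨h, hu⟩ := mem_defect_iff.1 hu
    have h1 := adjoint_isFormalAdjoint hd ⟨u, h⟩ ⟨x, hx⟩
    rw [hu, inner_neg_left, real_inner_smul_left] at h1
    rw [shift_apply, ← hle.2 (x := ⟨x, hx⟩) rfl, inner_add_right, real_inner_smul_right, ← h1]
    simp
  · have h2 := (S.kreinExtension_le_adjoint c).1 y.2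
    rw [(S.kreinExtension_le_adjoint c).2 (x := y) (y := ⟨y, h2⟩) rfl]
    exact hle.2 h

/-- Vectors in the domain of the Krein extension are, up to the defect space, limits of vectors in
the domain of `S` in the graph norm. -/
theorem exists_tendsto_of_mem_kreinExtension (hd : Dense (S.domain : Set E))
    (hs : S.IsFormalAdjoint S) (hn : ∀ x : S.domain, 0 ≤ ⟪S x, (x : E)⟫_ℝ) {c : ℝ} (hc : 0 < c)
    (z : S.adjoint.domain)
    (hz : (z : E) ∈ (S.kreinExtension c).domain) :
    ∃ (φ : ℕ → S.domain) (x : E), Tendsto (fun n => (φ n : E)) atTop (nhds x) ∧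
      Tendsto (fun n => S.shift c (φ n)) atTop (nhds (S.adjoint.shift c z)) ∧
      (z : E) - x ∈ S.defect c := by
  -- Taking complements, the orthogonal complement of the defect space lies in the closure of the
  -- range of `S + c`.
  have h1 : (LinearMap.range (S.shift c))ᗮ ≤ S.defect c := fun u hu =>
    mem_defect_of_forall hd fun x => by
      rw [real_inner_comm]
      exact (Submodule.mem_orthogonal _ _).1 hu _ ⟨x, rfl⟩
  have h2 := Submodule.orthogonal_le h1 ((mem_kreinExtension_domain z).1 hz)
  rw [Submodule.orthogonal_orthogonal_eq_closure] at h2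
  obtain ⟨y, hy, hlim⟩ := mem_closure_iff_seq_limit.1 h2
  choose φ hφ using hy
  have hlim' : Tendsto (fun n => S.shift c (φ n)) atTop (nhds (S.adjoint.shift c z)) := by
    simpa only [hφ] using hlim
  have hcau : CauchySeq fun n => (φ n : E) := by
    rw [Metric.cauchySeq_iff]
    intro ε hε
    obtain ⟨N, hN⟩ := Metric.cauchySeq_iff.1 hlim'.cauchySeq (c * ε) (mul_pos hc hε)
    refine ⟨N, fun m hm n hk => ?_⟩
    have h3 := hN m hm n hk
    rw [dist_eq_norm, ← LinearMap.map_sub] at h3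
    have h4 := (norm_le_norm_shift hn (φ m - φ n)).trans_lt h3
    rw [dist_eq_norm]
    exact lt_of_mul_lt_mul_left h4 hc.le
  obtain ⟨x, hx⟩ := cauchySeq_tendsto_of_complete hcau
  refine ⟨φ, x, hx, hlim', mem_defect_of_forall hd fun ψ => ?_⟩
  have h5 : Tendsto (fun n => ⟪S.shift c (φ n), (ψ : E)⟫_ℝ) atTop
      (nhds ⟪S.adjoint.shift c z, (ψ : E)⟫_ℝ) := hlim'.inner tendsto_const_nhds
  have h6 : Tendsto (fun n => ⟪(φ n : E), S.shift c ψ⟫_ℝ) atTop (nhds ⟪x, S.shift c ψ⟫_ℝ) :=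
    hx.inner tendsto_const_nhds
  simp only [inner_shift hs] at h5
  rw [inner_sub_left, ← inner_adjoint_shift hd, tendsto_nhds_unique h5 h6, sub_self]

/-- Write `z = x + u` with `x` a graph limit from `S` and `u` in the defect space. Since `(S† + c)w`
is orthogonal to `u`, only `x` is paired with it, and there symmetry passes to the limit. -/
theorem kreinExtension_isFormalAdjoint (hd : Dense (S.domain : Set E)) (hs : S.IsFormalAdjoint S)
    (hn : ∀ x : S.domain, 0 ≤ ⟪S x, (x : E)⟫_ℝ) {c : ℝ} (hc : 0 < c) :
    (S.kreinExtension c).IsFormalAdjoint (S.kreinExtension c) := by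
  have hle := S.kreinExtension_le_adjoint c
  rintro ⟨z, hz⟩ ⟨w, hw⟩
  rw [hle.2 (x := ⟨z, hz⟩) (y := ⟨z, hle.1 hz⟩) rfl, hle.2 (x := ⟨w, hw⟩) (y := ⟨w, hle.1 hw⟩) rfl]
  obtain ⟨φ, x, h1, h2, h3⟩ := exists_tendsto_of_mem_kreinExtension hd hs hn hc ⟨z, hle.1 hz⟩ hz
  have h4 : ⟪S.adjoint.shift c ⟨z, hle.1 hz⟩, w⟫_ℝ = ⟪x, S.adjoint.shift c ⟨w, hle.1 hw⟩⟫_ℝ := by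
    refine tendsto_nhds_unique (h2.inner (tendsto_const_nhds (x := w))) ?_
    refine (h1.inner (tendsto_const_nhds (x := S.adjoint.shift c ⟨w, hle.1 hw⟩))).congr fun n => ?_
    rw [real_inner_comm, inner_adjoint_shift hd c ⟨w, hle.1 hw⟩, real_inner_comm]
  have h5 := (Submodule.mem_orthogonal _ _).1
    ((mem_kreinExtension_domain ⟨w, hle.1 hw⟩).1 hw) _ h3
  rw [inner_sub_left, ← h4, shift_apply, shift_apply, inner_add_left, inner_add_right,
    real_inner_smul_left, real_inner_smul_right] at h5
  simp only at h5 ⊢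
  linarith

theorem adjoint_le_adjoint {A : E →ₗ.[ℝ] E} (hd : Dense (S.domain : Set E)) (h : S ≤ A) :
    A.adjoint ≤ S.adjoint := by
  refine IsFormalAdjoint.le_adjoint hd fun x y => ?_
  rw [h.2 (x := x) (y := ⟨x, h.1 x.2⟩) rfl]
  exact (adjoint_isFormalAdjoint (hd.mono h.1)).symm ⟨x, h.1 x.2⟩ y

/-- The extension `K` contains the defect space, so pairing `z ∈ D(K†)` with a defect vector shows
that `(S† + c)z` is orthogonal to it, which is the condition for `z ∈ D(K)`. -/
theorem isSelfAdjoint_kreinExtension (hd : Dense (S.domain : Set E)) (hs : S.IsFormalAdjoint S)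
    (hn : ∀ x : S.domain, 0 ≤ ⟪S x, (x : E)⟫_ℝ) {c : ℝ} (hc : 0 < c) :
    IsSelfAdjoint (S.kreinExtension c) := by
  have hSK := le_kreinExtension hd hs c
  have hKS := S.kreinExtension_le_adjoint c
  have hdK := hd.mono hSK.1
  have hKK := (kreinExtension_isFormalAdjoint hd hs hn hc).le_adjoint hdK
  have hadj := adjoint_le_adjoint hd hSK
  rw [isSelfAdjoint_def]
  refine (eq_of_le_of_domain_eq hKK (le_antisymm hKK.1 fun z hz => ?_)).symm
  rw [mem_kreinExtension_domain ⟨z, hadj.1 hz⟩, Submodule.mem_orthogonal]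
  intro u hu
  have huK := defect_le_kreinExtension_domain S c hu
  obtain ⟨huS, hu⟩ := mem_defect_iff.1 hu
  have h1 := adjoint_isFormalAdjoint hdK ⟨z, hz⟩ ⟨u, huK⟩
  rw [hKS.2 (x := ⟨u, huK⟩) (y := ⟨u, huS⟩) rfl, hu, inner_neg_right, real_inner_smul_right,
    hadj.2 (x := ⟨z, hz⟩) (y := ⟨z, hadj.1 hz⟩) rfl, real_inner_comm] at h1
  rw [shift_apply, inner_add_right, real_inner_smul_right, h1, real_inner_comm]
  simp

/-- A densely defined symmetric nonnegative operator with trivial defect space has a unique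
self-adjoint extension. -/
theorem existsUnique_of_defect_eq_bot (hd : Dense (S.domain : Set E)) (hs : S.IsFormalAdjoint S)
    (hn : ∀ x : S.domain, 0 ≤ ⟪S x, (x : E)⟫_ℝ) {c : ℝ} (hc : 0 < c) (hb : S.defect c = ⊥) :
    ∃! A : E →ₗ.[ℝ] E, S ≤ A ∧ IsSelfAdjoint A := by
  have hK : S.kreinExtension c = S.adjoint :=
    eq_of_le_of_domain_eq (S.kreinExtension_le_adjoint c)
      (le_antisymm (S.kreinExtension_le_adjoint c).1 fun z hz => by
        rw [mem_kreinExtension_domain ⟨z, hz⟩, hb]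
        simp)
  have hsa : IsSelfAdjoint S.adjoint := hK ▸ isSelfAdjoint_kreinExtension hd hs hn hc
  refine ⟨S.adjoint, ⟨hs.le_adjoint hd, hsa⟩, fun A ⟨hSA, hA⟩ => ?_⟩
  have h1 : A ≤ S.adjoint := isSelfAdjoint_def.1 hA ▸ adjoint_le_adjoint hd hSA
  have h2 := adjoint_le_adjoint (hd.mono hSA.1) h1
  rw [isSelfAdjoint_def.1 hA, isSelfAdjoint_def.1 hsa] at h2
  exact le_antisymm h1 h2

/-- If a densely defined symmetric nonnegative operator has a unique self-adjoint extension and the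
nonzero vectors of two of its defect spaces are never orthogonal, the first defect space is
trivial. -/
theorem defect_eq_bot_of_existsUnique (hd : Dense (S.domain : Set E)) (hs : S.IsFormalAdjoint S)
    (hn : ∀ x : S.domain, 0 ≤ ⟪S x, (x : E)⟫_ℝ) {c d : ℝ} (hc : 0 < c) (hcd : c < d)
    (ho : ∀ u ∈ S.defect c, ∀ v ∈ S.defect d, ⟪u, v⟫_ℝ = 0 → u = 0 ∨ v = 0)
    (hu : ∃! A : E →ₗ.[ℝ] E, S ≤ A ∧ IsSelfAdjoint A) : S.defect c = ⊥ := by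
  have hd0 := hc.trans hcd
  have hK : S.kreinExtension c = S.kreinExtension d :=
    hu.unique ⟨le_kreinExtension hd hs c, isSelfAdjoint_kreinExtension hd hs hn hc⟩
      ⟨le_kreinExtension hd hs d, isSelfAdjoint_kreinExtension hd hs hn hd0⟩
  rw [Submodule.eq_bot_iff]
  intro u huc
  by_contra hu0
  have huK := defect_le_kreinExtension_domain S c huc
  obtain ⟨huS, hu⟩ := mem_defect_iff.1 huc
  obtain ⟨φ, x, h1, h2, h3⟩ :=
    exists_tendsto_of_mem_kreinExtension hd hs hn hd0 ⟨u, huS⟩ (hK ▸ huK)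
  have hv : u - x = 0 := by
    refine (ho u huc _ h3 ?_).resolve_left hu0
    have hvK := hK ▸ defect_le_kreinExtension_domain S d h3
    obtain ⟨hvS, hv⟩ := mem_defect_iff.1 h3
    -- In the common extension `u` and `u - x` are eigenvectors for the distinct values `-c` and
    -- `-d`, hence orthogonal.
    have h4 := kreinExtension_isFormalAdjoint hd hs hn hc ⟨u, huK⟩ ⟨u - x, hvK⟩
    have hle := S.kreinExtension_le_adjoint c
    rw [hle.2 (x := ⟨u, huK⟩) (y := ⟨u, huS⟩) rfl, hle.2 (x := ⟨u - x, hvK⟩) (y := ⟨u - x, hvS⟩) rfl,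
      hu, hv, inner_neg_left, inner_neg_right, real_inner_smul_left, real_inner_smul_right] at h4
    have h5 : (d - c) * ⟪u, u - x⟫_ℝ = 0 := by
      simp only at h4
      linarith
    exact (mul_eq_zero.1 h5).resolve_left (sub_ne_zero.2 hcd.ne')
  rw [← sub_eq_zero.1 hv] at h1
  -- With `u = x` a graph limit from `S`, nonnegativity survives the limit, yet `⟪S†u, u⟫ = -c‖u‖² <
  -- 0`.
  have h6 : ⟪u, S.adjoint.shift d ⟨u, huS⟩⟫_ℝ - d * ⟪u, u⟫_ℝ ≥ 0 := by
    refine ge_of_tendsto' ((h1.inner h2).sub ((h1.inner h1).const_mul d)) fun n => ?_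
    rw [shift_apply, inner_add_right, real_inner_smul_right, real_inner_comm]
    linarith [hn (φ n)]
  rw [shift_apply, hu, inner_add_right, inner_neg_right, real_inner_smul_right,
    real_inner_smul_right] at h6
  have h7 : 0 < c * ⟪u, u⟫_ℝ := mul_pos hc (real_inner_self_pos.2 hu0)
  simp only at h6
  linarith

end LinearPMap

/-! ### Summation by parts and the energy -/

namespace BirthDeathChain

open scoped InnerProductSpace

variable (G : BirthDeathChain)

theorem hasSum_inner (f g : G.L2) : HasSum (fun x => f x * g x * G.m x) ⟪f, g⟫_ℝ := by
  have h := hasSum_integral_measure (L2.integrable_inner (𝕜 := ℝ) f g)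
  rw [L2.inner_def]
  refine h.congr_fun fun x => ?_
  rw [integral_smul_measure, integral_dirac, ENNReal.toReal_ofReal (G.m_pos x).le]
  simp
  ring

theorem inner_eq_sum {f g : G.L2} {N : ℕ} (hg : ∀ x, N ≤ x → g x = 0) :
    ⟪f, g⟫_ℝ = ∑ x ∈ Finset.range N, f x * g x * G.m x :=
  (G.hasSum_inner f g).unique (hasSum_sum_of_ne_finset_zero fun x hx => by
    simp [hg x (by simpa using hx)])

/-- The flux `b(x-1,x) (f(x) - f(x-1))` of `f` into the vertex `x` from below. -/
def flux (f : ℕ → ℝ) : ℕ → ℝ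
  | 0 => 0
  | k + 1 => G.b k (k + 1) * (f (k + 1) - f k)

theorem b_succ_pos (k : ℕ) : 0 < G.b k (k + 1) := by
  rw [G.b_pos_iff]
  simp

theorem measure_mul_laplacian (f : ℕ → ℝ) (x : ℕ) :
    G.m x * G.laplacian f x = G.flux f x - G.flux f (x + 1) := by
  rw [WeightedGraph.laplacian, ← mul_assoc, mul_one_div_cancel (G.m_pos x).ne', one_mul,
    tsum_eq_sum (s := Finset.range (x + 2)) fun y hy => by
      rw [G.b_eq_zero (Or.inl (not_lt.1 (Finset.mem_range.not.1 hy))), zero_mul]]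
  rw [Finset.sum_range_succ, Finset.sum_range_succ, sub_self, mul_zero, add_zero]
  cases x with
  | zero => simp [flux]; ring
  | succ k =>
    rw [Finset.sum_range_succ, Finset.sum_eq_zero fun y hy => by
      rw [G.b_eq_zero (Or.inr (by simpa using hy)), zero_mul]]
    simp only [flux, G.b_symm (k + 1) k]
    ring

/-- `mΔf` is a difference of consecutive fluxes, so this is Abel summation with a boundary term at
`N`. -/
theorem sum_mul_laplacian (f g : ℕ → ℝ) (N : ℕ) :
    ∑ x ∈ Finset.range N, g x * G.laplacian f x * G.m x =
      ∑ x ∈ Finset.range N, G.b x (x + 1) * (f (x + 1) - f x) * (g (x + 1) - g x) -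
        g N * G.flux f N := by
  induction N with
  | zero => simp [flux]
  | succ N ih =>
    rw [Finset.sum_range_succ, Finset.sum_range_succ, ih, mul_assoc, mul_comm _ (G.m N),
      measure_mul_laplacian]
    simp only [flux]
    ring

/-- Green's formula. -/
theorem sum_laplacian_mul (f g : ℕ → ℝ) {N : ℕ} (hg : ∀ x, N ≤ x → g x = 0) :
    ∑ x ∈ Finset.range (N + 1), G.laplacian f x * g x * G.m x =
      ∑ x ∈ Finset.range (N + 1), f x * G.laplacian g x * G.m x := by
  -- The range ends at `N + 1` because `Δg` can be nonzero at `N`; both boundary terms vanish since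
  -- `g` is zero at `N` and `N + 1`.
  have h := G.sum_mul_laplacian f g (N + 1)
  simp only [mul_comm (g _) (G.laplacian f _)] at h
  rw [h, sum_mul_laplacian]
  simp only [flux, hg (N + 1) (by omega), hg N le_rfl, sub_self, mul_zero, zero_mul, sub_zero]
  exact Finset.sum_congr rfl fun x _ => by ring

theorem laplacian_eq_zero {f : ℕ → ℝ} {N : ℕ} {a : ℝ} (hf : ∀ x, N ≤ x → f x = a) {x : ℕ}
    (hx : N < x) : G.laplacian f x = 0 := by
  have h := G.measure_mul_laplacian f x
  obtain ⟨k, rfl⟩ : ∃ k, x = k + 1 := ⟨x - 1, by omega⟩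
  simp only [flux, hf k (by omega), hf (k + 1) (by omega), hf (k + 1 + 1) (by omega), sub_self,
    mul_zero] at h
  exact (mul_eq_zero.1 h).resolve_left (G.m_pos _).ne'

/-- Each edge occurs in both orientations, which cancels the factor `1/2`. -/
theorem energy_eq_tsum (f : ℕ → ℝ) :
    G.energy f = ∑' k, ENNReal.ofReal (G.b k (k + 1) * (f (k + 1) - f k) ^ 2) := by
  set h : ℕ → ℝ≥0∞ := fun k => ENNReal.ofReal (G.b k (k + 1) * (f (k + 1) - f k) ^ 2) with hh
  have key : ∀ x y, ENNReal.ofReal (G.b x y * (f x - f y) ^ 2) =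
      (if y = x + 1 then h x else 0) + (if x = y + 1 then h y else 0) := by
    intro x y
    rcases lt_trichotomy (x + 1) y with hxy | rfl | hxy
    · rw [G.b_eq_zero (Or.inl hxy), if_neg (by omega), if_neg (by omega)]
      simp
    · rw [if_pos rfl, if_neg (by omega), add_zero, hh]
      congr 2
      ring
    · rw [if_neg (by omega), zero_add]
      rcases lt_trichotomy (y + 1) x with hyx | rfl | hyx
      · rw [G.b_eq_zero (Or.inr hyx), if_neg (by omega)]
        simp
      · rw [if_pos rfl, hh, G.b_symm]
      · obtain rfl : x = y := by omega
        rw [if_neg (by omega)]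
        simp
  simp only [WeightedGraph.energy, key, ENNReal.tsum_add]
  rw [ENNReal.tsum_comm (f := fun x y => if x = y + 1 then h y else 0)]
  simp only [tsum_ite_eq]
  rw [← two_mul, ← mul_assoc, ENNReal.div_mul_cancel (by simp) (by simp), one_mul]

theorem energy_const_sub (a : ℝ) (f : ℕ → ℝ) : G.energy (fun x => a - f x) = G.energy f := by
  simp only [WeightedGraph.energy]
  refine congrArg _ (tsum_congr fun x => tsum_congr fun y => ?_)
  congr 1
  ring

theorem energy_eq_ofReal {f : ℕ → ℝ} {N : ℕ} (hf : ∀ x, N ≤ x → f x = 0) :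
    G.energy f = ENNReal.ofReal (∑ x ∈ Finset.range N, f x * G.laplacian f x * G.m x) := by
  rw [energy_eq_tsum, tsum_eq_sum (s := Finset.range N) fun x hx => by
      have : N ≤ x := by simpa using hx
      simp [hf x this, hf (x + 1) (by omega)],
    ← ENNReal.ofReal_sum_of_nonneg fun x _ => mul_nonneg (G.b_nonneg _ _) (sq_nonneg _),
    sum_mul_laplacian, hf N le_rfl, zero_mul, sub_zero]
  exact congrArg _ (Finset.sum_congr rfl fun x _ => by ring)

/-! ### The operator `L_c` and its adjoint -/

theorem exists_forall_eq_zero {f : ℕ → ℝ} (hf : (Function.support f).Finite) :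
    ∃ N, ∀ x, N ≤ x → f x = 0 := by
  obtain ⟨N, hN⟩ := hf.bddAbove
  exact ⟨N + 1, fun x hx => by_contra fun h => absurd (hN h) (by omega)⟩

theorem mem_Cc {f : G.L2} {N : ℕ} (hf : ∀ x, N ≤ x → f x = 0) : f ∈ G.Cc :=
  (Set.finite_Iio N).subset fun x hx => by_contra fun h => hx (hf x (not_lt.1 h))

theorem coe_Lc (φ : G.Lc.domain) : (⇑(G.Lc φ) : ℕ → ℝ) = G.laplacian ((φ : G.L2) : ℕ → ℝ) :=
  G.eq_of_ae (MemLp.coeFn_toLp (G.memLp_of_finite (G.laplacian_finite φ.2)))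

theorem L2_ext {f g : G.L2} (h : ∀ x, f x = g x) : f = g :=
  Lp.ext (Eventually.of_forall h)

theorem coe_sub (f g : G.L2) : (⇑(f - g) : ℕ → ℝ) = f - g := G.eq_of_ae (Lp.coeFn_sub f g)

theorem coe_neg (f : G.L2) : (⇑(-f) : ℕ → ℝ) = -f := G.eq_of_ae (Lp.coeFn_neg f)

theorem coe_toLp {f : ℕ → ℝ} (hf : MemLp f 2 G.measure) : (⇑(hf.toLp f) : ℕ → ℝ) = f :=
  G.eq_of_ae hf.coeFn_toLp

theorem finite_support_single (x : ℕ) :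
    (Function.support (Pi.single x (1 : ℝ) : ℕ → ℝ)).Finite :=
  (Set.finite_singleton x).subset Pi.support_single_subset

/-- The indicator function of a vertex. -/
noncomputable def delta (x : ℕ) : G.Lc.domain :=
  ⟨(G.memLp_of_finite (finite_support_single x)).toLp _, by
    change (Function.support _).Finite
    rw [coe_toLp]
    exact finite_support_single x⟩

theorem coe_delta (x : ℕ) : (⇑(G.delta x : G.L2) : ℕ → ℝ) = Pi.single x 1 :=
  G.coe_toLp (G.memLp_of_finite (finite_support_single x))

theorem inner_delta (f : G.L2) (x : ℕ) : ⟪f, (G.delta x : G.L2)⟫_ℝ = f x * G.m x := by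
  refine (G.hasSum_inner _ _).unique ?_
  rw [coe_delta]
  convert hasSum_single x fun y hy => ?_ using 1
  · simp
  · simp [Pi.single_eq_of_ne hy]

theorem dense_Lc_domain : Dense (G.Lc.domain : Set G.L2) := by
  rw [Submodule.dense_iff_topologicalClosure_eq_top, Submodule.topologicalClosure_eq_top_iff,
    Submodule.eq_bot_iff]
  intro f hf
  refine G.L2_ext fun x => ?_
  have h := (Submodule.mem_orthogonal _ _).1 hf _ (G.delta x).2
  rw [real_inner_comm, inner_delta] at h
  rw [coe_zero]
  exact (mul_eq_zero.1 h).resolve_right (G.m_pos x).ne'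

theorem inner_laplacian {f g : G.L2} (hg : ∀ x, g x = G.laplacian f x) (φ : G.Lc.domain) :
    ⟪g, (φ : G.L2)⟫_ℝ = ⟪f, G.Lc φ⟫_ℝ := by
  obtain ⟨N, hN⟩ := exists_forall_eq_zero φ.2
  rw [G.inner_eq_sum (N := N + 1) fun x hx => hN x (by omega),
    G.inner_eq_sum (N := N + 1) fun x hx => by
      rw [coe_Lc, G.laplacian_eq_zero hN (by omega)], coe_Lc, ← G.sum_laplacian_mul f _ hN]
  simp only [hg]

theorem adjoint_apply (f : G.Lc.adjoint.domain) :
    (⇑(G.Lc.adjoint f) : ℕ → ℝ) = G.laplacian ((f : G.L2) : ℕ → ℝ) := by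
  funext x
  have h := G.Lc.adjoint_isFormalAdjoint G.dense_Lc_domain f (G.delta x)
  obtain ⟨N, hN⟩ := exists_forall_eq_zero (G.delta x).2
  rw [inner_delta, G.inner_eq_sum (N := N + 1) fun x hx => by
      rw [coe_Lc, G.laplacian_eq_zero hN (by omega)], coe_Lc, ← G.sum_laplacian_mul _ _ hN] at h
  rw [Finset.sum_eq_single x (fun y _ hy => by simp [coe_delta, Pi.single_eq_of_ne hy])
    (fun hx => by rw [hN x (by simp at hx; omega)]; simp), coe_delta] at h
  simpa [(G.m_pos x).ne'] using h

theorem mem_adjoint_domain {f g : G.L2} (hg : ∀ x, g x = G.laplacian f x) :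
    f ∈ G.Lc.adjoint.domain :=
  LinearPMap.mem_adjoint_domain_of_exists _ ⟨g, G.inner_laplacian hg⟩

theorem Lc_isFormalAdjoint : G.Lc.IsFormalAdjoint G.Lc := fun φ ψ =>
  G.inner_laplacian (fun x => by rw [coe_Lc]) ψ

theorem energy_eq_inner (φ : G.Lc.domain) :
    G.energy ((φ : G.L2) : ℕ → ℝ) = ENNReal.ofReal ⟪G.Lc φ, (φ : G.L2)⟫_ℝ := by
  obtain ⟨N, hN⟩ := exists_forall_eq_zero φ.2
  rw [G.energy_eq_ofReal hN, G.inner_eq_sum hN, coe_Lc]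
  exact congrArg _ (Finset.sum_congr rfl fun x _ => by ring)

theorem Lc_nonneg (φ : G.Lc.domain) : 0 ≤ ⟪G.Lc φ, (φ : G.L2)⟫_ℝ := by
  obtain ⟨N, hN⟩ := exists_forall_eq_zero φ.2
  rw [real_inner_comm, G.inner_eq_sum (N := N + 1) fun x hx => by
      rw [coe_Lc, G.laplacian_eq_zero hN (by omega)], coe_Lc, sum_mul_laplacian,
    hN (N + 1) (by omega), zero_mul, sub_zero]
  refine Finset.sum_nonneg fun x _ => ?_
  rw [mul_assoc]
  exact mul_nonneg (G.b_nonneg _ _) (mul_self_nonneg _)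

/-! ### Sign and growth of defect vectors -/

/-- Solutions of `Δ u = -c u` that are nonnegative at `0` are nondecreasing. -/
theorem monotone_of_laplacian_eq {u : ℕ → ℝ} {c : ℝ} (hc : 0 ≤ c)
    (hu : ∀ x, G.laplacian u x = -(c * u x)) (h0 : 0 ≤ u 0) : Monotone u := by
  have h : ∀ x, 0 ≤ u x ∧ 0 ≤ G.flux u x ∧ u x ≤ u (x + 1) := by
    have step : ∀ x, 0 ≤ u x → 0 ≤ G.flux u x → 0 ≤ G.flux u (x + 1) ∧ u x ≤ u (x + 1) := by
      intro x h1 h2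
      have h3 := G.measure_mul_laplacian u x
      have h4 : 0 ≤ G.m x * (c * u x) := mul_nonneg (G.m_pos x).le (mul_nonneg hc h1)
      rw [hu x] at h3
      have h5 : 0 ≤ G.flux u (x + 1) := by linarith
      exact ⟨h5, sub_nonneg.1 (nonneg_of_mul_nonneg_right h5 (G.b_succ_pos x))⟩
    intro x
    induction x with
    | zero => exact ⟨h0, le_rfl, (step 0 h0 le_rfl).2⟩
    | succ x ih =>
      have h1 := ih.1.trans ih.2.2
      have h2 := (step x ih.1 ih.2.1).1
      exact ⟨h1, h2, (step _ h1 h2).2⟩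
  exact monotone_nat_of_le_succ fun x => (h x).2.2

theorem laplacian_of_mem_defect {c : ℝ} {u : G.L2} (hu : u ∈ G.Lc.defect c) (x : ℕ) :
    G.laplacian u x = -(c * u x) := by
  obtain ⟨h, hu⟩ := LinearPMap.mem_defect_iff.1 hu
  have h1 := G.adjoint_apply ⟨u, h⟩
  rw [hu, coe_neg, coe_smul] at h1
  simpa using (congrFun h1 x).symm

/-- Elements of the defect space have a constant sign and are bounded below by their value at
`0`. -/
theorem sq_le_of_mem_defect {c : ℝ} (hc : 0 ≤ c) {u : G.L2} (hu : u ∈ G.Lc.defect c) (x : ℕ) :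
    u 0 ^ 2 ≤ u 0 * u x := by
  -- Scaling by `u 0` makes the initial value `u(0)² ≥ 0`, whatever the sign of `u`.
  have h := G.monotone_of_laplacian_eq hc
    (G.laplacian_of_mem_defect (Submodule.smul_mem _ (u 0) hu)) (by
      rw [coe_smul]
      exact mul_self_nonneg _) (Nat.zero_le x)
  rw [coe_smul] at h
  simpa [sq] using h

/-- Both `u` and `-u` are nondecreasing from `0`. -/
theorem eq_zero_of_mem_defect {c : ℝ} (hc : 0 ≤ c) {u : G.L2} (hu : u ∈ G.Lc.defect c)
    (h0 : u 0 = 0) : u = 0 := by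
  refine G.L2_ext fun x => ?_
  have h1 := G.monotone_of_laplacian_eq hc (G.laplacian_of_mem_defect hu) h0.ge (Nat.zero_le x)
  have h2 := G.monotone_of_laplacian_eq hc
    (G.laplacian_of_mem_defect (neg_mem hu)) (by rw [coe_neg]; simp [h0]) (Nat.zero_le x)
  rw [coe_neg] at h2
  simp only [Pi.neg_apply] at h2
  rw [coe_zero, Pi.zero_apply]
  linarith

/-- After multiplication by `u(0)v(0)` all terms of the inner product are nonnegative, so each
vanishes; the term at `0` is `u(0)²v(0)²m(0)`. -/
theorem eq_zero_of_inner_defect_eq_zero {c d : ℝ} (hc : 0 ≤ c) (hd : 0 ≤ d) {u v : G.L2}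
    (hu : u ∈ G.Lc.defect c) (hv : v ∈ G.Lc.defect d) (h : ⟪u, v⟫_ℝ = 0) : u = 0 ∨ v = 0 := by
  have h0 : ∀ x, 0 ≤ u 0 * v 0 * (u x * v x * G.m x) := fun x => by
    have h2 := mul_nonneg ((sq_nonneg _).trans (G.sq_le_of_mem_defect hc hu x))
      ((sq_nonneg _).trans (G.sq_le_of_mem_defect hd hv x))
    linarith [mul_nonneg h2 (G.m_pos x).le]
  have h1 := (G.hasSum_inner u v).mul_left (u 0 * v 0)
  rw [h, mul_zero, hasSum_zero_iff_of_nonneg h0] at h1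
  have h2 := congrFun h1 0
  simp [(G.m_pos 0).ne'] at h2
  rcases h2 with h2 | h2
  · exact Or.inl (G.eq_zero_of_mem_defect hc hu h2)
  · exact Or.inr (G.eq_zero_of_mem_defect hd hv h2)

end BirthDeathChain

/-! ### Essential self-adjointness and capacity -/

namespace BirthDeathChain

open scoped InnerProductSpace

variable (G : BirthDeathChain)

theorem isEssentiallySelfAdjoint_iff : G.IsEssentiallySelfAdjoint ↔ G.Lc.defect 1 = ⊥ :=
  ⟨LinearPMap.defect_eq_bot_of_existsUnique G.dense_Lc_domain G.Lc_isFormalAdjoint G.Lc_nonneg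
    one_pos one_lt_two fun _ hu _ hv =>
      G.eq_zero_of_inner_defect_eq_zero zero_le_one zero_le_two hu hv,
  LinearPMap.existsUnique_of_defect_eq_bot G.dense_Lc_domain G.Lc_isFormalAdjoint G.Lc_nonneg
    one_pos⟩

theorem laplacian_const (a : ℝ) (x : ℕ) : G.laplacian (fun _ => a) x = 0 := by
  simp [WeightedGraph.laplacian]

theorem energy_const (a : ℝ) : G.energy (fun _ => a) = 0 := by
  simp [WeightedGraph.energy]

theorem exists_const_one (h : MemLp (fun _ => (1 : ℝ)) 2 G.measure) :
    ∃ f : G.Lc.adjoint.domain, (⇑(f : G.L2) : ℕ → ℝ) = (fun _ => 1) ∧ G.Lc.adjoint f = 0 := by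
  have hmem : h.toLp _ ∈ G.Lc.adjoint.domain := G.mem_adjoint_domain (g := 0) fun x => by
    rw [coe_zero, coe_toLp, laplacian_const, Pi.zero_apply]
  refine ⟨⟨_, hmem⟩, G.coe_toLp h, G.L2_ext fun x => ?_⟩
  rw [adjoint_apply, coe_zero, coe_toLp, laplacian_const, Pi.zero_apply]

theorem testFunctions_ne_empty (h : MemLp (fun _ => (1 : ℝ)) 2 G.measure) (n : ℕ) :
    G.testFunctions n ≠ ∅ := by
  obtain ⟨f, hf, -⟩ := G.exists_const_one h
  refine Set.Nonempty.ne_empty ⟨f, ?_, fun r _ => by rw [hf]⟩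
  change G.energy _ < ∞
  rw [hf, energy_const]
  exact ENNReal.zero_lt_top

theorem memLp_one (h : ¬ ∃ n, G.testFunctions n = ∅) :
    MemLp (fun _ => (1 : ℝ)) 2 G.measure := by
  -- A member of `𝒞_0` is the constant `1` itself.
  obtain ⟨f, -, hf⟩ := Set.nonempty_iff_ne_empty.2 (not_exists.1 h 0)
  rw [← show (⇑(f : G.L2) : ℕ → ℝ) = fun _ => 1 from funext fun r => hf r (Nat.zero_le r)]
  exact Lp.memLp _

theorem memLp_one_of_mem_defect {c : ℝ} (hc : 0 ≤ c) {u : G.L2} (hu : u ∈ G.Lc.defect c)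
    (h0 : u 0 ≠ 0) : MemLp (fun _ => (1 : ℝ)) 2 G.measure := by
  refine (Lp.memLp u).of_le_mul (c := |u 0|⁻¹) aestronglyMeasurable_const
    (Eventually.of_forall fun x => ?_)
  have h1 : 0 < |u 0| := abs_pos.2 h0
  have h2 : |u 0| * |u 0| ≤ |u 0| * |u x| := by
    rw [← abs_mul, ← abs_mul, ← sq, abs_of_nonneg (sq_nonneg _)]
    exact (G.sq_le_of_mem_defect hc hu x).trans (le_abs_self _)
  have h3 := le_of_mul_le_mul_left h2 h1
  simp only [Real.norm_eq_abs, abs_one]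
  rwa [← div_eq_inv_mul, one_le_div h1]

theorem cap22_le (h : ¬ ∃ n, G.testFunctions n = ∅) {n : ℕ} {f : G.Lc.adjoint.domain}
    (hf : f ∈ G.testFunctions n) : G.cap22 ≤ G.normSqH2 f := by
  have hanti : Antitone fun n : ℕ => ⨅ f ∈ G.testFunctions n, G.normSqH2 f := fun i j hij =>
    biInf_mono fun f hf => ⟨hf.1, fun r hr => hf.2 r (hij.trans hr)⟩
  exact (hanti.le_of_tendsto (G.tendsto_cap22 h) n).trans (iInf₂_le f hf)

theorem cap22_eq_top_iff : G.cap22 = ∞ ↔ ∃ n, G.testFunctions n = ∅ := by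
  refine ⟨fun h => ?_, fun h => by rw [cap22, if_pos h]⟩
  by_contra hne
  obtain ⟨f, hf⟩ := Set.nonempty_iff_ne_empty.2 (not_exists.1 hne 0)
  have h1 := G.cap22_le hne hf
  rw [h, top_le_iff, normSqH2] at h1
  have h2 : G.energy ((f : G.L2) : ℕ → ℝ) ≠ ∞ := (show G.energy _ < ∞ from hf.1).ne
  simp [h2] at h1

theorem defect_eq_bot_of_cap22_eq_top (h : G.cap22 = ∞) : G.Lc.defect 1 = ⊥ := by
  rw [Submodule.eq_bot_iff]
  intro u hu
  refine G.eq_zero_of_mem_defect zero_le_one hu (by_contra fun h0 => ?_)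
  obtain ⟨n, hn⟩ := G.cap22_eq_top_iff.1 h
  exact G.testFunctions_ne_empty (G.memLp_one_of_mem_defect zero_le_one hu h0) n hn

/-- Since `1 - f` is finitely supported, pairing it with `L_c^* u = -u` gives `⟪u, 1⟫ = ⟪u, f⟫ + ⟪u,
L_c^* f⟫`. -/
theorem inner_one_le {u : G.L2} (hu : u ∈ G.Lc.defect 1) {e f : G.Lc.adjoint.domain}
    (he : (⇑(e : G.L2) : ℕ → ℝ) = fun _ => 1) (he0 : G.Lc.adjoint e = 0) {n : ℕ}
    (hf : f ∈ G.testFunctions n) :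
    |⟪u, (e : G.L2)⟫_ℝ| ≤ ‖u‖ * (‖(f : G.L2)‖ + ‖G.Lc.adjoint f‖) := by
  obtain ⟨hu', hu⟩ := LinearPMap.mem_defect_iff.1 hu
  have hφ : ((e - f : G.Lc.adjoint.domain) : G.L2) ∈ G.Cc := G.mem_Cc (N := n) fun x hx => by
    rw [Submodule.coe_sub, coe_sub, he, Pi.sub_apply, hf.2 x hx, sub_self]
  have h1 := G.Lc.adjoint_isFormalAdjoint G.dense_Lc_domain ⟨u, hu'⟩ ⟨_, hφ⟩
  have h2 : G.Lc ⟨_, hφ⟩ = -G.Lc.adjoint f := by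
    rw [(G.Lc_isFormalAdjoint.le_adjoint G.dense_Lc_domain).2 (x := ⟨_, hφ⟩) (y := e - f) rfl,
      LinearPMap.map_sub, he0, zero_sub]
  rw [h2, hu, one_smul] at h1
  simp only [Submodule.coe_sub, inner_neg_left, inner_neg_right, inner_sub_right] at h1
  have h3 : ⟪u, (e : G.L2)⟫_ℝ = ⟪u, (f : G.L2)⟫_ℝ + ⟪u, G.Lc.adjoint f⟫_ℝ := by linarith
  rw [h3, mul_add]
  exact (abs_add_le _ _).trans
    (add_le_add (abs_real_inner_le_norm _ _) (abs_real_inner_le_norm _ _))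

theorem exists_normSqH2_lt (h : G.cap22 = 0) {ε : ℝ≥0∞} (hε : 0 < ε) :
    ∃ n, ∃ f ∈ G.testFunctions n, G.normSqH2 f < ε := by
  have hne : ¬ ∃ n, G.testFunctions n = ∅ := fun hn => by
    rw [G.cap22_eq_top_iff.2 hn] at h
    exact ENNReal.top_ne_zero h
  obtain ⟨n, hn⟩ := ((G.tendsto_cap22 hne).eventually_lt_const (h ▸ hε)).exists
  simp only [iInf_lt_iff] at hn
  obtain ⟨f, hf, hlt⟩ := hn
  exact ⟨n, f, hf, hlt⟩

theorem norm_lt_of_normSqH2_lt {f : G.Lc.adjoint.domain} {ε : ℝ} (hε : 0 ≤ ε)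
    (h : G.normSqH2 f < ENNReal.ofReal (ε ^ 2)) :
    ‖(f : G.L2)‖ < ε ∧ ‖G.Lc.adjoint f‖ < ε := by
  have key : ∀ v : G.L2, ‖v‖ₑ ^ 2 ≤ G.normSqH2 f → ‖v‖ < ε := fun v hv => by
    have h1 := hv.trans_lt h
    rw [← ofReal_norm, ← ENNReal.ofReal_pow (norm_nonneg _)] at h1
    exact lt_of_pow_lt_pow_left₀ 2 hε (lt_of_not_ge fun h2 => h1.not_ge (ENNReal.ofReal_le_ofReal h2))
  exact ⟨key _ (le_add_right le_self_add), key _ (le_add_right le_add_self)⟩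

theorem defect_eq_bot_of_cap22_eq_zero (h : G.cap22 = 0) : G.Lc.defect 1 = ⊥ := by
  have hne : ¬ ∃ n, G.testFunctions n = ∅ := fun hn => by
    rw [G.cap22_eq_top_iff.2 hn] at h
    exact ENNReal.top_ne_zero h
  obtain ⟨e, he, he0⟩ := G.exists_const_one (G.memLp_one hne)
  -- The constant `1` is a defect vector for the shift `0`, so the sign argument applies to the pair
  -- `u`, `1`.
  have he1 : (e : G.L2) ∈ G.Lc.defect 0 :=
    LinearPMap.mem_defect_iff.2 ⟨e.2, by rw [zero_smul, neg_zero]; exact he0⟩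
  rw [Submodule.eq_bot_iff]
  intro u hu
  have h0 : ⟪u, (e : G.L2)⟫_ℝ = 0 := by
    rw [← abs_nonpos_iff]
    have hlim : Tendsto (fun ε : ℝ => ‖u‖ * (ε + ε)) (nhdsWithin 0 (Set.Ioi 0)) (nhds 0) := by
      have : Continuous fun ε : ℝ => ‖u‖ * (ε + ε) := by fun_prop
      simpa using (this.tendsto 0).mono_left nhdsWithin_le_nhds
    refine ge_of_tendsto hlim (eventually_nhdsWithin_of_forall fun ε hε => ?_)
    have hε : 0 < ε := hε
    obtain ⟨n, f, hf, hlt⟩ := G.exists_normSqH2_lt h (ENNReal.ofReal_pos.2 (pow_pos hε 2))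
    obtain ⟨h1, h2⟩ := G.norm_lt_of_normSqH2_lt hε.le hlt
    exact (G.inner_one_le hu he he0 hf).trans
      (mul_le_mul_of_nonneg_left (add_le_add h1.le h2.le) (norm_nonneg _))
  refine (G.eq_zero_of_inner_defect_eq_zero zero_le_one le_rfl hu he1 h0).resolve_right fun h1 => ?_
  rw [h1, coe_zero] at he
  exact zero_ne_one (congrFun he 0)

theorem cap22_eq_zero_of_defect_eq_bot (hb : G.Lc.defect 1 = ⊥)
    (hne : ¬ ∃ n, G.testFunctions n = ∅) : G.cap22 = 0 := by
  obtain ⟨e, he, he0⟩ := G.exists_const_one (G.memLp_one hne)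
  have hsym := G.Lc_isFormalAdjoint.le_adjoint G.dense_Lc_domain
  -- With trivial defect space the Krein domain is all of `D(L_c^*)`, and `1` itself is the graph
  -- limit of the `φ k`.
  obtain ⟨φ, x, h1, h2, h3⟩ := LinearPMap.exists_tendsto_of_mem_kreinExtension G.dense_Lc_domain
    G.Lc_isFormalAdjoint G.Lc_nonneg one_pos e (by
      rw [LinearPMap.mem_kreinExtension_domain, hb]
      simp)
  rw [hb, Submodule.mem_bot, sub_eq_zero] at h3
  subst h3
  have h4 : Tendsto (fun k => G.Lc (φ k)) atTop (nhds 0) := by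
    have := h2.sub h1
    simpa [LinearPMap.shift_apply, he0] using this
  let f : ℕ → G.Lc.adjoint.domain := fun k => e - ⟨φ k, hsym.1 (φ k).2⟩
  have hf : ∀ k, G.Lc.adjoint (f k) = -G.Lc (φ k) := fun k => by
    rw [LinearPMap.map_sub, he0, zero_sub, hsym.2 (x := φ k) (y := ⟨φ k, hsym.1 (φ k).2⟩) rfl]
  have hcoe : ∀ k, (⇑(f k : G.L2) : ℕ → ℝ) = fun x => 1 - (φ k : G.L2) x := fun k => by
    change ⇑((e : G.L2) - (φ k : G.L2)) = _
    rw [coe_sub, he]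
    rfl
  -- Energy ignores constants, so `Q(1 - φ) = ⟪L_c φ, φ⟫`, which tends to `⟪0, 1⟫ = 0`; graph
  -- convergence already controls the energy.
  have henergy : ∀ k, G.energy (f k : G.L2) = ENNReal.ofReal ⟪G.Lc (φ k), (φ k : G.L2)⟫_ℝ :=
    fun k => by rw [hcoe, energy_const_sub, energy_eq_inner]
  have hle : ∀ k, G.cap22 ≤ G.normSqH2 (f k) := fun k => by
    obtain ⟨N, hN⟩ := exists_forall_eq_zero (φ k).2
    refine G.cap22_le hne (n := N) ⟨?_, fun r hr => by simp only [hcoe, hN r hr, sub_zero]⟩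
    change G.energy _ < ∞
    rw [henergy]
    exact ENNReal.ofReal_lt_top
  have h5 : Tendsto (fun k => (f k : G.L2)) atTop (nhds 0) := by
    rw [← sub_self (e : G.L2)]
    exact tendsto_const_nhds.sub h1
  have hlim : Tendsto (fun k => G.normSqH2 (f k)) atTop (nhds 0) := by
    have ha := (ENNReal.continuous_pow 2).continuousAt.tendsto.comp h5.enorm
    have hb := (ENNReal.continuous_pow 2).continuousAt.tendsto.comp h4.enorm
    have hc := ENNReal.tendsto_ofReal (h4.inner (𝕜 := ℝ) h1)
    simpa [normSqH2, hf, henergy] using (ha.add hb).add hc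
  exact le_antisymm (ge_of_tendsto' hlim hle) zero_le

end BirthDeathChain

theorem theoremt (G : BirthDeathChain) :
    G.IsEssentiallySelfAdjoint ↔ G.cap22 = 0 ∨ G.cap22 = ∞ := by
  rw [G.isEssentiallySelfAdjoint_iff]
  refine ⟨fun h => ?_, fun h => h.elim G.defect_eq_bot_of_cap22_eq_zero
    G.defect_eq_bot_of_cap22_eq_top⟩
  by_cases hne : ∃ n, G.testFunctions n = ∅
  · exact Or.inr (G.cap22_eq_top_iff.2 hne)
  · exact Or.inl (G.cap22_eq_zero_of_defect_eq_bot h hne)
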